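/- Let $Y = XB^* + C^* + \mathcal E$ with a fixed design $X\in\mathbb R^{n\times p}$, coefficient matrix $B^*\in\mathbb R^{p\times m}$, outlier matrix $C^*\in\mathbb R^{n\times m}$, and a random noise matrix $\mathcal E\in\mathbb R^{n\times m}$ which has independent $N(0,\sigma^2)$ entries or, more generally, is sub-Gaussian with scale $\sigma>0$, i.e. $\mathbb E\, e^{\langle V,\mathcal E\rangle}\le e^{\sigma^2\|V\|_F^2/2}$ for every $V\in\mathbb R^{n\times m}$. Write $q=\operatorname{rank}(X)$, $M(B,C)=\|XB+C\|_F^2$, $\|C\|_{2,1}=\sum_{i=1}^n\|c_i\|_2$ and $\|C_{\mathcal J}\|_{2,1}=\sum_{i\in\mathcal J}\|c_i\|_2$, where $c_1,\dots,c_n$ are the rows of $C$, and put $\mathcal J(C)=\{i: c_i\ne 0\}$, $J(C)=|\mathcal J(C)|$. For every $\vartheta>0$ there is $A_0>0$ depending only on $\vartheta$ such that for every $A\ge A_0$ there is a constant $c>0$ depending only on $\vartheta$ and $A$ with the following property, for all $n,m,p,r,\sigma,X,B^*,C^*$ and $\mathcal E$ as above. Let $(\hat B,\hat C)$ be a (measurable)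 global minimizer of $$\tfrac12\|Y-XB-C\|_F^2+\lambda\|C\|_{2,1}\quad\text{subject to }\operatorname{rank}(B)\le r,\qquad \lambda=A\sigma(m+\log n)^{1/2}.$$ Let $B\in\mathbb R^{p\times m}$ with $\operatorname{rank}(B)\le r$, $C\in\mathbb R^{n\times m}$ and $K\ge0$ be such that, with $\mathcal J=\mathcal J(C)$, $$(1+\vartheta)\|C'_{\mathcal J}\|_{2,1}\le\|C'_{\mathcal J^c}\|_{2,1}+K|\mathcal J|^{1/2}\|(I-P)C'\|_F$$ for all $C'\in\mathbb R^{n\times m}$ and all orthogonal projection matrices $P\in\mathbb R^{n\times n}$ of rank at most $2r$ whose range is contained in the column space of $X$. Then $M(\hat B-B^*,\hat C-C^*)$ is integrable and $$\mathbb E\,M(\hat B-B^*,\hat C-C^*)\le c\left\{M(B-B^*,C-C^*)+\sigma^2+\sigma^2(q+m)r+\sigma^2K^2J(C)(m+\log n)\right\}.$$ -/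

import Mathlib

open MeasureTheory ProbabilityTheory

/-- Squared Frobenius norm of a real matrix. -/
def frobSq {n m : ℕ} (A : Matrix (Fin n) (Fin m) ℝ) : ℝ := ∑ i, ∑ j, A i j ^ 2

/-- Frobenius norm. -/
noncomputable def frobNorm {n m : ℕ} (A : Matrix (Fin n) (Fin m) ℝ) : ℝ := Real.sqrt (frobSq A)

/-- Euclidean norm of the `i`-th row of a matrix. -/
noncomputable def rowNorm {n m : ℕ} (A : Matrix (Fin n) (Fin m) ℝ) (i : Fin n) : ℝ :=
  Real.sqrt (∑ j, A i j ^ 2)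

/-- The group norm of the rows indexed by `s`, that is `∑ i ∈ s, ‖a_i‖₂`. -/
noncomputable def groupNormOn {n m : ℕ} (s : Finset (Fin n)) (A : Matrix (Fin n) (Fin m) ℝ) : ℝ :=
  ∑ i ∈ s, rowNorm A i

open Classical in
/-- The set of (indices of) nonzero rows of a matrix. -/
noncomputable def rowSupport {n m : ℕ} (C : Matrix (Fin n) (Fin m) ℝ) : Finset (Fin n) :=
  Finset.univ.filter (fun i => C i ≠ 0)

/-- The prediction loss `M(B, C) = ‖X B + C‖_F²`. -/
noncomputable def predLoss {n m p : ℕ} (X : Matrix (Fin n) (Fin p) ℝ)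
    (B : Matrix (Fin p) (Fin m) ℝ) (C : Matrix (Fin n) (Fin m) ℝ) : ℝ :=
  frobSq (X * B + C)

/-- The group-`ℓ₁` penalized least squares objective
`‖Y - X B - C‖_F² / 2 + lam * ‖C‖_{2,1}`. -/
noncomputable def objective {n m p : ℕ} (X : Matrix (Fin n) (Fin p) ℝ)
    (Y : Matrix (Fin n) (Fin m) ℝ) (lam : ℝ)
    (B : Matrix (Fin p) (Fin m) ℝ) (C : Matrix (Fin n) (Fin m) ℝ) : ℝ :=
  frobSq (Y - X * B - C) / 2 + lam * groupNormOn Finset.univ C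

/-- `(Bhat, Chat)` is a global minimizer of the objective subject to `rank B ≤ r`. -/
def IsRankConstrainedMinimizer {n m p : ℕ} (X : Matrix (Fin n) (Fin p) ℝ)
    (Y : Matrix (Fin n) (Fin m) ℝ) (lam : ℝ) (r : ℕ)
    (Bhat : Matrix (Fin p) (Fin m) ℝ) (Chat : Matrix (Fin n) (Fin m) ℝ) : Prop :=
  Bhat.rank ≤ r ∧
    ∀ (B : Matrix (Fin p) (Fin m) ℝ) (C : Matrix (Fin n) (Fin m) ℝ), B.rank ≤ r →
      objective X Y lam Bhat Chat ≤ objective X Y lam B C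

/-- The incoherence condition on the design `X` relative to the row set `J`, with constants
`K` and `ϑ`: for every matrix `C'` and every orthogonal projection matrix `P` of rank at most
`2 r` whose range lies in the column space of `X`,
`(1 + ϑ) ‖C'_J‖_{2,1} ≤ ‖C'_{Jᶜ}‖_{2,1} + K |J|^{1/2} ‖(I - P) C'‖_F`. -/
def Incoherence {n p : ℕ} (m : ℕ) (X : Matrix (Fin n) (Fin p) ℝ) (r : ℕ)
    (J : Finset (Fin n)) (K ϑ : ℝ) : Prop :=
  ∀ (C' : Matrix (Fin n) (Fin m) ℝ) (P : Matrix (Fin n) (Fin n) ℝ),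
    IsStarProjection P →
    LinearMap.range P.mulVecLin ≤ LinearMap.range X.mulVecLin →
    P.rank ≤ 2 * r →
    (1 + ϑ) * groupNormOn J C' ≤
      groupNormOn Jᶜ C' + K * Real.sqrt (J.card : ℝ) * frobNorm ((1 - P) * C')

/-- The entries of the random matrix `E` are independent `N(0, σ²)` variables. -/
def IsGaussianNoise {Ω : Type*} [MeasurableSpace Ω] {n m : ℕ} (μ : Measure Ω) (σ : ℝ)
    (E : Ω → Matrix (Fin n) (Fin m) ℝ) : Prop :=
  iIndepFun (fun (ij : Fin n × Fin m) (ω : Ω) => E ω ij.1 ij.2) μ ∧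
    ∀ (i : Fin n) (j : Fin m), μ.map (fun ω => E ω i j) = gaussianReal 0 (Real.toNNReal (σ ^ 2))

/-- The vectorization of the random matrix `E` is a (centred) sub-Gaussian vector with scale `σ`:
every linear functional `⟨V, E⟩` satisfies `𝔼 exp ⟨V, E⟩ ≤ exp (σ² ‖V‖_F² / 2)`. -/
def IsSubGaussianNoise {Ω : Type*} [MeasurableSpace Ω] {n m : ℕ} (μ : Measure Ω) (σ : ℝ)
    (E : Ω → Matrix (Fin n) (Fin m) ℝ) : Prop :=
  (∀ (i : Fin n) (j : Fin m), AEMeasurable (fun ω => E ω i j) μ) ∧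
  ∀ V : Matrix (Fin n) (Fin m) ℝ,
    Integrable (fun ω => Real.exp (∑ i, ∑ j, V i j * E ω i j)) μ ∧
      ∫ ω, Real.exp (∑ i, ∑ j, V i j * E ω i j) ∂μ ≤ Real.exp (σ ^ 2 * frobSq V / 2)

/-- Independent `N(0, σ²)` entries form sub-Gaussian noise of scale `σ`. -/
theorem IsGaussianNoise.isSubGaussianNoise {Ω : Type*} [MeasurableSpace Ω] {n m : ℕ}
    {μ : Measure Ω} {σ : ℝ} {E : Ω → Matrix (Fin n) (Fin m) ℝ}
    (h : IsGaussianNoise μ σ E) : IsSubGaussianNoise μ σ E := by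
  obtain ⟨hind, hlaw⟩ := h
  have hm : ∀ i j, AEMeasurable (fun ω => E ω i j) μ := fun i j =>
    aemeasurable_of_map_neZero (by rw [hlaw i j]; infer_instance)
  have hσ : ((Real.toNNReal (σ ^ 2) : NNReal) : ℝ) = σ ^ 2 := Real.coe_toNNReal _ (sq_nonneg σ)
  refine ⟨hm, fun V => ?_⟩
  have hsub : ∀ ij : Fin n × Fin m, HasSubgaussianMGF (fun ω => V ij.1 ij.2 * E ω ij.1 ij.2)
      (Real.toNNReal (V ij.1 ij.2 ^ 2 * σ ^ 2)) μ := by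
    intro ij
    have hmap := hlaw ij.1 ij.2
    have hc : ((Real.toNNReal (V ij.1 ij.2 ^ 2 * σ ^ 2) : NNReal) : ℝ)
        = V ij.1 ij.2 ^ 2 * σ ^ 2 := Real.coe_toNNReal _ (by positivity)
    refine ⟨fun t => ?_, fun t => ?_⟩
    · have h1 := integrable_exp_mul_gaussianReal (μ := 0) (v := Real.toNNReal (σ ^ 2))
        (t * V ij.1 ij.2)
      rw [← hmap] at h1
      have h2 := h1.comp_aemeasurable (hm ij.1 ij.2)
      refine h2.congr (Filter.Eventually.of_forall fun ω => ?_)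
      simp only [Function.comp]
      ring_nf
    · have h1 := mgf_gaussianReal hmap (t * V ij.1 ij.2)
      have h2 : mgf (fun ω => V ij.1 ij.2 * E ω ij.1 ij.2) μ t
          = mgf (fun ω => E ω ij.1 ij.2) μ (t * V ij.1 ij.2) := by
        simp only [mgf]
        congr 1
        funext ω
        ring_nf
      rw [h2, h1, hc, hσ]
      apply le_of_eq
      ring_nf
  have hind2 : iIndepFun (fun (ij : Fin n × Fin m) (ω : Ω) => V ij.1 ij.2 * E ω ij.1 ij.2) μ :=
    hind.comp (fun ij x => V ij.1 ij.2 * x) (fun ij => measurable_const_mul _)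
  have hsum := HasSubgaussianMGF.sum_of_iIndepFun hind2 (s := Finset.univ) (fun ij _ => hsub ij)
  have hI := hsum.integrable_exp_mul 1
  have hM := hsum.mgf_le 1
  have hc : ((∑ ij : Fin n × Fin m, Real.toNNReal (V ij.1 ij.2 ^ 2 * σ ^ 2) : NNReal) : ℝ)
      = σ ^ 2 * frobSq V := by
    rw [NNReal.coe_sum, frobSq, Finset.mul_sum, Fintype.sum_prod_type]
    refine Finset.sum_congr rfl fun i _ => ?_
    rw [Finset.mul_sum]
    refine Finset.sum_congr rfl fun j _ => ?_
    rw [Real.coe_toNNReal _ (by positivity)]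
    ring
  simp only [mgf, one_mul, Fintype.sum_prod_type] at hI hM
  refine ⟨hI, hM.trans (le_of_eq ?_)⟩
  rw [Fintype.sum_prod_type] at hc
  rw [hc]
  ring_nf

/-! Comparing the objective at the minimizer and at `(B, C)` leaves one random term, the inner
product of the noise with `D = X (Bhat - B) + Δ`, where `Δ = Chat - C`. Let `P` project onto the
column space of `X (Bhat - B)`, so that `(1 - P) D = (1 - P) Δ` and `D` splits orthogonally into `P
D`, of rank at most `2 r`, and `(1 - P) Δ`, which has the form `X U + Δ` with `X U` of rank at most
`2 r`.

Since `P` is random, the noise is bounded uniformly over all sums of a low-rank and a row-sparse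
matrix (`exists_noise_bound`). Low-rank matrices are discretized through their factors, sparse ones
row set by row set. Sub-Gaussian tails beat the net sizes, and the `log n` per row pays for the
union over row sets. The random excess `G` has mean of order `σ ^ 2`, so an expectation bound
follows without truncating to an event.

`Δ` need not be sparse. `le_groupNorm_of_le_card` turns a price per nonzero row into a multiple of
the group norm: large rows are few, and a small row is interpolated between zero and a row of
threshold size. The resulting group-norm term is absorbed by the penalty and the incoherence
condition (`IsRankConstrainedMinimizer.predLoss_le`). -/

/-! ### Nets in normed spaces and for tuples of low rank -/

/-- The unit ball of a finite-dimensional real normed space has a `1/2`-net of at most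
`5 ^ dim` points. -/
theorem exists_half_net (V : Type*) [NormedAddCommGroup V] [NormedSpace ℝ V]
    [FiniteDimensional ℝ V] :
    ∃ N : Finset V, N.card ≤ 5 ^ Module.finrank ℝ V ∧ (∀ v ∈ N, ‖v‖ ≤ 1) ∧
      ∀ x : V, ‖x‖ ≤ 1 → ∃ v ∈ N, ‖x - v‖ ≤ 1 / 2 := by
  classical
  -- A 1-separated set of maximal size in the ball of radius 2 is a 1-net of that ball. Comparing
  -- volumes of balls of radius 1/2 and 5/2 bounds its size by `5 ^ dim`; halving it gives the net.
  let good : Finset V → Prop := fun s =>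
    (∀ c ∈ s, ‖c‖ ≤ 2) ∧ ∀ c ∈ s, ∀ d ∈ s, c ≠ d → 1 ≤ ‖c - d‖
  let T : Set ℕ := {k | ∃ s, good s ∧ s.card = k}
  have hbdd : BddAbove T := by
    refine ⟨5 ^ Module.finrank ℝ V, ?_⟩
    rintro _ ⟨s, hs, rfl⟩
    exact Besicovitch.card_le_of_separated s hs.1 hs.2
  have hne : T.Nonempty := ⟨0, ∅, by simp [good], rfl⟩
  obtain ⟨s, hs, hcard⟩ := Nat.sSup_mem hne hbdd
  have hnet : ∀ x : V, ‖x‖ ≤ 2 → ∃ v ∈ s, ‖x - v‖ ≤ 1 := by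
    intro x hx
    by_contra! hfar
    have hxs : x ∉ s := fun h => by simpa using (hfar x h).trans_le' zero_le_one
    have hgood : good (insert x s) := by
      refine ⟨fun c hc => ?_, fun c hc d hd hcd => ?_⟩
      · rcases Finset.mem_insert.1 hc with rfl | hc
        exacts [hx, hs.1 c hc]
      · rcases Finset.mem_insert.1 hc with rfl | hc
        · rcases Finset.mem_insert.1 hd with rfl | hd
          exacts [absurd rfl hcd, (hfar d hd).le]
        · rcases Finset.mem_insert.1 hd with hdx | hd
          · rw [hdx, norm_sub_rev]
            exact (hfar c hc).le
          · exact hs.2 c hc d hd hcd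
    have hle : (insert x s).card ≤ sSup T := le_csSup hbdd ⟨_, hgood, rfl⟩
    rw [Finset.card_insert_of_notMem hxs, hcard] at hle
    omega
  refine ⟨s.image (fun v => (1 / 2 : ℝ) • v), ?_, ?_, ?_⟩
  · exact Finset.card_image_le.trans (Besicovitch.card_le_of_separated s hs.1 hs.2)
  · intro v hv
    obtain ⟨c, hc, rfl⟩ := Finset.mem_image.1 hv
    rw [norm_smul, Real.norm_of_nonneg (by norm_num)]
    linarith [hs.1 c hc]
  · intro x hx
    obtain ⟨v, hv, hxv⟩ := hnet ((2 : ℝ) • x) (by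
      rw [norm_smul, Real.norm_of_nonneg (by norm_num)]; linarith)
    refine ⟨_, Finset.mem_image_of_mem _ hv, ?_⟩
    have : x - (1 / 2 : ℝ) • v = (1 / 2 : ℝ) • ((2 : ℝ) • x - v) := by
      rw [smul_sub, smul_smul]; norm_num
    rw [this, norm_smul, Real.norm_of_nonneg (by norm_num)]
    linarith

/-- An operator bounded by `M` on a `1/2`-net of the unit ball has norm at most `2 M`. -/
theorem ContinuousLinearMap.opNorm_le_of_half_net {V F : Type*} [NormedAddCommGroup V]
    [NormedSpace ℝ V] [NormedAddCommGroup F] [NormedSpace ℝ F] {N : Finset V}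
    (hN : ∀ x : V, ‖x‖ ≤ 1 → ∃ v ∈ N, ‖x - v‖ ≤ 1 / 2) (g : V →L[ℝ] F) {M : ℝ}
    (hM : ∀ v ∈ N, ‖g v‖ ≤ M) : ‖g‖ ≤ 2 * M := by
  have hM0 : 0 ≤ M := by
    obtain ⟨v, hv, -⟩ := hN 0 (by simp)
    exact (norm_nonneg _).trans (hM v hv)
  -- A unit vector is a net point plus an error of norm at most 1/2, on which `g` costs at most `‖g‖
  -- / 2`; this is absorbed on the left.
  have h : ‖g‖ ≤ M + ‖g‖ / 2 := by
    refine ContinuousLinearMap.opNorm_le_of_unit_norm (by positivity) fun x hx => ?_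
    obtain ⟨v, hv, hxv⟩ := hN x hx.le
    have h1 : g x = g v + g (x - v) := by rw [map_sub]; abel
    rw [h1]
    refine (norm_add_le _ _).trans (add_le_add (hM v hv) ((g.le_opNorm _).trans ?_))
    nlinarith [norm_nonneg g]
  linarith

/-- Vectors spanning a space of dimension at most `s` are images of vectors of the same norms in
the `s`-dimensional Euclidean space, under a contraction. -/
theorem exists_contraction_factor {H ι : Type*} [NormedAddCommGroup H] [InnerProductSpace ℝ H]
    [FiniteDimensional ℝ H] (s : ℕ) (w : ι → H)
    (hs : Module.finrank ℝ (Submodule.span ℝ (Set.range w)) ≤ s) :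
    ∃ (A : EuclideanSpace ℝ (Fin s) →L[ℝ] H) (b : ι → EuclideanSpace ℝ (Fin s)),
      ‖A‖ ≤ 1 ∧ (∀ j, A (b j) = w j) ∧ ∀ j, ‖b j‖ = ‖w j‖ := by
  set U := Submodule.span ℝ (Set.range w) with hU
  let bU := stdOrthonormalBasis ℝ U
  let f : U →ₗ[ℝ] EuclideanSpace ℝ (Fin s) :=
    bU.toBasis.constr ℝ (fun i => EuclideanSpace.basisFun (Fin s) ℝ (Fin.castLE hs i))
  have hf : (f ∘ bU.toBasis) =
      fun i => EuclideanSpace.basisFun (Fin s) ℝ (Fin.castLE hs i) := by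
    funext i
    simp only [f, Function.comp, Module.Basis.constr_basis]
  let φ : U →ₗᵢ[ℝ] EuclideanSpace ℝ (Fin s) :=
    f.isometryOfOrthonormal (v := bU.toBasis) (by simp [bU.orthonormal]) (by
      rw [hf]
      exact (EuclideanSpace.basisFun (Fin s) ℝ).orthonormal.comp _ (Fin.castLE_injective hs))
  have hmem : ∀ j, w j ∈ U := fun j => Submodule.subset_span ⟨j, rfl⟩
  -- The adjoint of the isometric embedding `φ` of `U` is a contraction and a left inverse of `φ`.
  refine ⟨U.subtypeL ∘L ContinuousLinearMap.adjoint φ.toContinuousLinearMap,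
    fun j => φ ⟨w j, hmem j⟩, ?_, fun j => ?_, fun j => ?_⟩
  · refine (ContinuousLinearMap.opNorm_comp_le _ _).trans ?_
    have h2 : ‖ContinuousLinearMap.adjoint φ.toContinuousLinearMap‖ ≤ 1 := by
      rw [LinearIsometryEquiv.norm_map]
      exact φ.norm_toContinuousLinearMap_le
    exact mul_le_one₀ U.norm_subtypeL_le (norm_nonneg _) h2
  · have h1 : ContinuousLinearMap.adjoint φ.toContinuousLinearMap (φ ⟨w j, hmem j⟩)
        = ⟨w j, hmem j⟩ := by
      refine ext_inner_right ℝ fun x => ?_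
      rw [ContinuousLinearMap.adjoint_inner_left]
      exact φ.inner_map_map _ _
    simp only [ContinuousLinearMap.comp_apply, h1]
    rfl
  · rw [φ.norm_map]
    rfl

/-- A bilinear form bounded by `M` on a product of `1/2`-nets of the unit balls is bounded by
`4 M` on the product of the unit balls. -/
theorem LinearMap.le_of_half_nets {V₁ V₂ : Type*} [NormedAddCommGroup V₁] [NormedSpace ℝ V₁]
    [FiniteDimensional ℝ V₁] [NormedAddCommGroup V₂] [NormedSpace ℝ V₂] [FiniteDimensional ℝ V₂]
    {N₁ : Finset V₁} {N₂ : Finset V₂}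
    (hN₁ : ∀ x : V₁, ‖x‖ ≤ 1 → ∃ v ∈ N₁, ‖x - v‖ ≤ 1 / 2)
    (hN₂ : ∀ x : V₂, ‖x‖ ≤ 1 → ∃ v ∈ N₂, ‖x - v‖ ≤ 1 / 2) (T : V₁ →ₗ[ℝ] V₂ →ₗ[ℝ] ℝ) {M : ℝ}
    (hM : ∀ v₁ ∈ N₁, ∀ v₂ ∈ N₂, |T v₁ v₂| ≤ M) (x₁ : V₁) (x₂ : V₂) :
    T x₁ x₂ ≤ 4 * M * ‖x₁‖ * ‖x₂‖ := by
  let g : V₁ →L[ℝ] V₂ →L[ℝ] ℝ := LinearMap.toContinuousLinearMap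
    ((LinearMap.toContinuousLinearMap (𝕜 := ℝ) (E := V₂) (F' := ℝ)).toLinearMap ∘ₗ T)
  have hg : ∀ a b, g a b = T a b := fun _ _ => rfl
  have hgn : ‖g‖ ≤ 2 * (2 * M) := ContinuousLinearMap.opNorm_le_of_half_net hN₁ g fun a ha =>
    ContinuousLinearMap.opNorm_le_of_half_net hN₂ (g a) fun b hb => hM a ha b hb
  calc T x₁ x₂ ≤ ‖g x₁ x₂‖ := Real.le_norm_self _
    _ ≤ ‖g‖ * ‖x₁‖ * ‖x₂‖ := g.le_opNorm₂ _ _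
    _ ≤ 2 * (2 * M) * ‖x₁‖ * ‖x₂‖ := by gcongr
    _ = 4 * M * ‖x₁‖ * ‖x₂‖ := by ring

/-- The bilinear form `(A, b) ↦ ∑ j, ⟪e j, A (b j)⟫`. -/
noncomputable def tupleForm {H G ι : Type*} [NormedAddCommGroup H] [InnerProductSpace ℝ H]
    [NormedAddCommGroup G] [NormedSpace ℝ G] [Fintype ι] (e : ι → H) :
    (G →L[ℝ] H) →ₗ[ℝ] (PiLp 2 fun _ : ι => G) →ₗ[ℝ] ℝ :=
  LinearMap.mk₂ ℝ (fun A b => ∑ j, inner ℝ (e j) (A (b j)))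
    (fun A A' b => by simp [inner_add_right, Finset.sum_add_distrib])
    (fun a A b => by simp [inner_smul_right, Finset.mul_sum])
    (fun A b b' => by simp [inner_add_right, Finset.sum_add_distrib])
    (fun a A b => by simp [inner_smul_right, Finset.mul_sum])

theorem tupleForm_apply {H G ι : Type*} [NormedAddCommGroup H] [InnerProductSpace ℝ H]
    [NormedAddCommGroup G] [NormedSpace ℝ G] [Fintype ι] (e : ι → H)
    (A : G →L[ℝ] H) (b : PiLp 2 fun _ : ι => G) :
    tupleForm e A b = ∑ j, inner ℝ (e j) (A (b j)) := rfl

/-- A finite family of tuples of vectors controlling a linear functional on all tuples of vectors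
which span a space of dimension at most `s`. -/
theorem exists_lowRank_net (H ι : Type*) [NormedAddCommGroup H] [InnerProductSpace ℝ H]
    [FiniteDimensional ℝ H] [Fintype ι] (s : ℕ) :
    ∃ N : Finset (ι → H), N.card ≤ 5 ^ (s * Module.finrank ℝ H + Fintype.card ι * s) ∧
      (∀ v ∈ N, ∑ j, ‖v j‖ ^ 2 ≤ 1) ∧
      ∀ (e : ι → H) (y : ℝ), (∀ v ∈ N, |∑ j, inner ℝ (e j) (v j)| ≤ y) →
        ∀ w : ι → H, Module.finrank ℝ (Submodule.span ℝ (Set.range w)) ≤ s →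
          ∑ j, inner ℝ (e j) (w j) ≤ 4 * y * Real.sqrt (∑ j, ‖w j‖ ^ 2) := by
  classical
  have : FiniteDimensional ℝ (EuclideanSpace ℝ (Fin s) →L[ℝ] H) :=
    LinearEquiv.finiteDimensional (LinearMap.toContinuousLinearMap
      (𝕜 := ℝ) (E := EuclideanSpace ℝ (Fin s)) (F' := H))
  have hd₁ : Module.finrank ℝ (EuclideanSpace ℝ (Fin s) →L[ℝ] H) = s * Module.finrank ℝ H := by
    rw [← (LinearMap.toContinuousLinearMap
      (𝕜 := ℝ) (E := EuclideanSpace ℝ (Fin s)) (F' := H)).finrank_eq,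
      Module.finrank_linearMap, finrank_euclideanSpace_fin]
  have hd₂ : Module.finrank ℝ (PiLp 2 fun _ : ι => EuclideanSpace ℝ (Fin s))
      = Fintype.card ι * s := by
    rw [(WithLp.linearEquiv 2 ℝ (∀ _ : ι, EuclideanSpace ℝ (Fin s))).finrank_eq,
      Module.finrank_pi_fintype]
    simp
  -- Tuples of rank at most `s` are not a linear space, so the nets are taken over the factors `A`
  -- and `b`, on which the form is bilinear.
  obtain ⟨N₁, hc₁, hn₁, hN₁⟩ := exists_half_net (EuclideanSpace ℝ (Fin s) →L[ℝ] H)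
  obtain ⟨N₂, hc₂, hn₂, hN₂⟩ := exists_half_net (PiLp 2 fun _ : ι => EuclideanSpace ℝ (Fin s))
  refine ⟨(N₁ ×ˢ N₂).image fun Ab j => Ab.1 (Ab.2 j), ?_, ?_, ?_⟩
  · refine Finset.card_image_le.trans ?_
    rw [Finset.card_product, pow_add, ← hd₁, ← hd₂]
    exact Nat.mul_le_mul hc₁ hc₂
  · intro v hv
    obtain ⟨⟨A, b⟩, hAb, rfl⟩ := Finset.mem_image.1 hv
    obtain ⟨hA, hb⟩ := Finset.mem_product.1 hAb
    have hsq : ∑ j, ‖A (b j)‖ ^ 2 ≤ ‖b‖ ^ 2 := by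
      rw [PiLp.norm_sq_eq_of_L2]
      refine Finset.sum_le_sum fun j _ => pow_le_pow_left₀ (norm_nonneg _) ?_ 2
      exact (A.le_of_opNorm_le (hn₁ A hA) _).trans_eq (one_mul _)
    exact hsq.trans (pow_le_one₀ (norm_nonneg b) (hn₂ b hb))
  · intro e y hy w hrank
    obtain ⟨A, b, hA, hAb, hbn⟩ := exists_contraction_factor s w hrank
    have hM : ∀ A ∈ N₁, ∀ b ∈ N₂, |tupleForm e A b| ≤ y := fun A hA b hb =>
      hy _ (Finset.mem_image.2 ⟨(A, b), Finset.mk_mem_product hA hb, rfl⟩)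
    have hy0 : 0 ≤ y := by
      obtain ⟨a, ha, -⟩ := hN₁ 0 (norm_zero.trans_le zero_le_one)
      obtain ⟨b, hb, -⟩ := hN₂ 0 (norm_zero.trans_le zero_le_one)
      exact (abs_nonneg _).trans (hM a ha b hb)
    have hb : ‖WithLp.toLp 2 b‖ = Real.sqrt (∑ j, ‖w j‖ ^ 2) := by
      rw [PiLp.norm_eq_of_L2]
      simp only [hbn]
    have h := LinearMap.le_of_half_nets hN₁ hN₂ (tupleForm e) hM A (WithLp.toLp 2 b)
    rw [tupleForm_apply, hb] at h
    simp only [hAb] at h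
    refine h.trans (mul_le_mul_of_nonneg_right ?_ (Real.sqrt_nonneg _))
    nlinarith

/-! ### Frobenius geometry and restriction to rows -/

/-- The Frobenius inner product of two real matrices. -/
def frobInner {n m : ℕ} (A B : Matrix (Fin n) (Fin m) ℝ) : ℝ := ∑ i, ∑ j, A i j * B i j

section Frobenius

variable {n m : ℕ} (A B C : Matrix (Fin n) (Fin m) ℝ)

theorem frobInner_comm : frobInner A B = frobInner B A := by
  simp only [frobInner, mul_comm]

theorem frobInner_add_right : frobInner A (B + C) = frobInner A B + frobInner A C := by
  simp [frobInner, mul_add, Finset.sum_add_distrib]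

theorem frobInner_smul_right (t : ℝ) : frobInner A (t • B) = t * frobInner A B := by
  simp [frobInner, Finset.mul_sum, mul_left_comm]

theorem frobSq_eq_frobInner : frobSq A = frobInner A A := by
  simp [frobSq, frobInner, sq]

theorem frobSq_nonneg : 0 ≤ frobSq A :=
  Finset.sum_nonneg fun _ _ => Finset.sum_nonneg fun _ _ => sq_nonneg _

theorem frobNorm_nonneg : 0 ≤ frobNorm A := Real.sqrt_nonneg _

theorem frobNorm_sq : frobNorm A ^ 2 = frobSq A := Real.sq_sqrt (frobSq_nonneg A)

theorem frobSq_add : frobSq (A + B) = frobSq A + 2 * frobInner A B + frobSq B := by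
  simp only [frobSq, frobInner, Finset.mul_sum, ← Finset.sum_add_distrib, Matrix.add_apply]
  exact Finset.sum_congr rfl fun i _ => Finset.sum_congr rfl fun j _ => by ring

theorem frobSq_smul (t : ℝ) : frobSq (t • A) = t ^ 2 * frobSq A := by
  simp [frobSq, Finset.mul_sum, mul_pow]

theorem rowNorm_nonneg (i : Fin n) : 0 ≤ rowNorm A i := Real.sqrt_nonneg _

theorem rowNorm_sq (i : Fin n) : rowNorm A i ^ 2 = ∑ j, A i j ^ 2 :=
  Real.sq_sqrt (Finset.sum_nonneg fun _ _ => sq_nonneg _)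

/-- The rows of `A` indexed by `s`, the other rows being replaced by zero. -/
def keepRows (s : Finset (Fin n)) : Matrix (Fin n) (Fin m) ℝ :=
  Matrix.of fun i j => if i ∈ s then A i j else 0

theorem keepRows_add_keepRows_compl (s : Finset (Fin n)) :
    keepRows A s + keepRows A sᶜ = A := by
  ext i j
  by_cases h : i ∈ s <;> simp [keepRows, h]

theorem frobInner_keepRows_compl (s : Finset (Fin n)) :
    frobInner (keepRows A s) (keepRows B sᶜ) = 0 := by
  refine Finset.sum_eq_zero fun i _ => Finset.sum_eq_zero fun j _ => ?_
  by_cases h : i ∈ s <;> simp [keepRows, h]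

theorem keepRows_mul {p : ℕ} (X : Matrix (Fin n) (Fin p) ℝ) (U : Matrix (Fin p) (Fin m) ℝ)
    (s : Finset (Fin n)) : keepRows (X * U) s = keepRows X s * U := by
  ext i j
  by_cases h : i ∈ s <;> simp [keepRows, h, Matrix.mul_apply]

theorem rank_keepRows_le (s : Finset (Fin n)) : (keepRows A s).rank ≤ A.rank := by
  have h : keepRows A s = Matrix.diagonal (fun i => if i ∈ s then (1 : ℝ) else 0) * A := by
    ext i j
    by_cases h : i ∈ s <;> simp [keepRows, h]
  rw [h]
  exact Matrix.rank_mul_le_right _ _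

end Frobenius

/-! ### Nets for low-rank and row-sparse matrices -/

/-- A net for the matrices of rank at most `s` with columns in the column space of `X`. -/
theorem exists_lowRank_matrix_net {n m p : ℕ} (X : Matrix (Fin n) (Fin p) ℝ) (s : ℕ) :
    ∃ N : Finset (Matrix (Fin n) (Fin m) ℝ), N.card ≤ 5 ^ ((X.rank + m) * s) ∧
      (∀ V ∈ N, frobSq V ≤ 1) ∧
      ∀ (E : Matrix (Fin n) (Fin m) ℝ) (y : ℝ), (∀ V ∈ N, |frobInner E V| ≤ y) →
        ∀ U : Matrix (Fin p) (Fin m) ℝ, (X * U).rank ≤ s →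
          frobInner E (X * U) ≤ 4 * y * frobNorm (X * U) := by
  classical
  let L := (WithLp.linearEquiv 2 ℝ (Fin n → ℝ)).symm
  let S : Submodule ℝ (EuclideanSpace ℝ (Fin n)) :=
    (LinearMap.range X.mulVecLin).map L.toLinearMap
  have hS : Module.finrank ℝ S = X.rank := LinearEquiv.finrank_map_eq L _
  let col : Matrix (Fin n) (Fin m) ℝ → Fin m → EuclideanSpace ℝ (Fin n) :=
    fun A j => L (A.col j)
  have hinner : ∀ A B, ∑ j, inner ℝ (col A j) (col B j) = frobInner A B := by
    intro A B
    simp only [frobInner, col, PiLp.inner_apply]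
    rw [Finset.sum_comm]
    refine Finset.sum_congr rfl fun i _ => Finset.sum_congr rfl fun j _ => ?_
    simp [L, mul_comm]
  have hnorm : ∀ A, ∑ j, ‖col A j‖ ^ 2 = frobSq A := by
    intro A
    rw [frobSq_eq_frobInner, ← hinner]
    simp
  -- Working inside the column space makes the exponent involve `X.rank` instead of `n`; the noise
  -- is then tested through its projection onto `S`.
  obtain ⟨N, hcard, hN, hsup⟩ := exists_lowRank_net S (Fin m) s
  let mat : (Fin m → S) → Matrix (Fin n) (Fin m) ℝ :=
    fun v => Matrix.of fun i j => (v j : EuclideanSpace ℝ (Fin n)) i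
  have hcol : ∀ v j, col (mat v) j = v j := fun v j => rfl
  refine ⟨N.image mat, ?_, ?_, ?_⟩
  · refine Finset.card_image_le.trans (hcard.trans (le_of_eq ?_))
    rw [hS, Fintype.card_fin]
    ring
  · intro V hV
    obtain ⟨v, hv, rfl⟩ := Finset.mem_image.1 hV
    rw [← hnorm]
    exact hN v hv
  · intro E y hy U hU
    have hproj : ∀ (x : EuclideanSpace ℝ (Fin n)) (v : S),
        inner ℝ (S.orthogonalProjectionOnto x) v = inner ℝ x (v : EuclideanSpace ℝ (Fin n)) :=
      fun x v => S.inner_orthogonalProjectionOnto_eq_of_mem_right v x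
    let w : Fin m → S := fun j => ⟨col (X * U) j, ⟨_, ⟨U.col j, rfl⟩, rfl⟩⟩
    have hrank : Module.finrank ℝ (Submodule.span ℝ (Set.range w)) ≤ s := by
      have h1 : (Submodule.span ℝ (Set.range w)).map S.subtype
          = (Submodule.span ℝ (Set.range (X * U).col)).map L.toLinearMap := by
        rw [Submodule.map_span, Submodule.map_span, ← Set.range_comp, ← Set.range_comp]
        rfl
      rw [← Submodule.finrank_map_subtype_eq, h1, LinearEquiv.finrank_map_eq,
        ← Matrix.rank_eq_finrank_span_cols]
      exact hU
    have h := hsup (fun j => S.orthogonalProjectionOnto (col E j)) y (fun v hv => ?_) w hrank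
    · simp only [hproj] at h
      rw [← hinner, frobNorm, ← hnorm]
      exact h
    · have h2 := hy _ (Finset.mem_image_of_mem mat hv)
      rw [← hinner] at h2
      simp only [hproj]
      exact h2

/-- A net for the matrices whose nonzero rows are indexed by `J`. -/
theorem exists_rows_net {n m : ℕ} (J : Finset (Fin n)) :
    ∃ N : Finset (Matrix (Fin n) (Fin m) ℝ), N.card ≤ 5 ^ (J.card * m) ∧
      (∀ V ∈ N, frobSq V ≤ 1) ∧
      ∀ (E : Matrix (Fin n) (Fin m) ℝ) (y : ℝ), (∀ V ∈ N, |frobInner E V| ≤ y) →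
        ∀ C : Matrix (Fin n) (Fin m) ℝ,
          frobInner E (keepRows C J) ≤ 2 * y * frobNorm (keepRows C J) := by
  classical
  let mat : EuclideanSpace ℝ (J × Fin m) → Matrix (Fin n) (Fin m) ℝ :=
    fun v => Matrix.of fun i j => if h : i ∈ J then v (⟨i, h⟩, j) else 0
  have hsum : ∀ f : Fin n → ℝ, (∀ i ∉ J, f i = 0) → ∑ i, f i = ∑ i : J, f i := by
    intro f hf
    rw [Finset.sum_coe_sort J f]
    exact (Finset.sum_subset (Finset.subset_univ J) fun i _ hi => hf i hi).symm
  have hinner : ∀ E v, frobInner E (mat v) = inner ℝ (WithLp.toLp 2 fun ij : J × Fin m =>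
      E ij.1 ij.2) v := by
    intro E v
    rw [frobInner, hsum _ (fun i hi => by simp [mat, hi]), PiLp.inner_apply,
      Fintype.sum_prod_type]
    refine Finset.sum_congr rfl fun i _ => Finset.sum_congr rfl fun j _ => ?_
    simp [mat, mul_comm]
  have hnorm : ∀ v, frobSq (mat v) = ‖v‖ ^ 2 := by
    intro v
    rw [frobSq_eq_frobInner, hinner, ← real_inner_self_eq_norm_sq]
    congr 1
    ext ij
    simp [mat]
  obtain ⟨N, hcard, hN, hnet⟩ := exists_half_net (EuclideanSpace ℝ (J × Fin m))
  refine ⟨N.image mat, ?_, ?_, ?_⟩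
  · refine Finset.card_image_le.trans (hcard.trans (le_of_eq ?_))
    simp
  · intro V hV
    obtain ⟨v, hv, rfl⟩ := Finset.mem_image.1 hV
    rw [hnorm]
    exact pow_le_one₀ (norm_nonneg _) (hN v hv)
  · intro E y hy C
    let c : EuclideanSpace ℝ (J × Fin m) := WithLp.toLp 2 fun ij : J × Fin m => C ij.1 ij.2
    have hc : keepRows C J = mat c := by
      ext i j
      by_cases h : i ∈ J <;> simp [keepRows, mat, c, h]
    rw [hc, frobNorm, hnorm, Real.sqrt_sq (norm_nonneg _), hinner]
    let g := innerSL ℝ (WithLp.toLp 2 fun ij : J × Fin m => E ij.1 ij.2)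
    have hg : ‖g‖ ≤ 2 * y := ContinuousLinearMap.opNorm_le_of_half_net hnet g fun v hv => by
      have := hy _ (Finset.mem_image_of_mem mat hv)
      rwa [hinner] at this
    exact (Real.le_norm_self _).trans (g.le_of_opNorm_le hg c)

/-- A net for the sums of a matrix of rank at most `s` with columns in the column space of `X` and
a matrix whose nonzero rows are indexed by `J`. -/
theorem exists_lowRank_add_rows_net {n p : ℕ} (m : ℕ) (X : Matrix (Fin n) (Fin p) ℝ) (s : ℕ)
    (J : Finset (Fin n)) :
    ∃ N : Finset (Matrix (Fin n) (Fin m) ℝ),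
      N.card ≤ 2 * 5 ^ ((X.rank + m) * s + J.card * m) ∧ (∀ V ∈ N, frobSq V ≤ 1) ∧
      ∀ (E : Matrix (Fin n) (Fin m) ℝ) (y : ℝ), 0 ≤ y → (∀ V ∈ N, |frobInner E V| ≤ y) →
        ∀ (U : Matrix (Fin p) (Fin m) ℝ) (C : Matrix (Fin n) (Fin m) ℝ), (X * U).rank ≤ s →
          (∀ i ∉ J, C i = 0) →
          frobInner E (X * U + C) ≤ 6 * y * frobNorm (X * U + C) := by
  classical
  -- The two summands of `X U + C` need not be orthogonal, but its rows in and outside `J` are: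
  -- those in `J` are treated as arbitrary, and outside `J` only the low-rank part `keepRows X Jᶜ *
  -- U` remains. The constants 4 and 2 of the two nets add up to 6.
  obtain ⟨N₁, hc₁, hn₁, h₁⟩ := exists_lowRank_matrix_net (m := m) (keepRows X Jᶜ) s
  obtain ⟨N₂, hc₂, hn₂, h₂⟩ := exists_rows_net (m := m) J
  refine ⟨N₁ ∪ N₂, ?_, ?_, ?_⟩
  · refine (Finset.card_union_le _ _).trans ?_
    have hq := rank_keepRows_le X Jᶜ
    have h1 : N₁.card ≤ 5 ^ ((X.rank + m) * s + J.card * m) := by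
      refine hc₁.trans (Nat.pow_le_pow_right (by norm_num) ?_)
      exact (Nat.mul_le_mul_right s (by omega)).trans (Nat.le_add_right _ _)
    have h2 : N₂.card ≤ 5 ^ ((X.rank + m) * s + J.card * m) :=
      hc₂.trans (Nat.pow_le_pow_right (by norm_num) (Nat.le_add_left _ _))
    omega
  · intro V hV
    rcases Finset.mem_union.1 hV with h | h
    exacts [hn₁ V h, hn₂ V h]
  · intro E y hy0 hy U C hU hC
    set Z := X * U + C with hZ
    have hZc : keepRows Z Jᶜ = keepRows X Jᶜ * U := by
      rw [← keepRows_mul]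
      ext i j
      by_cases h : i ∈ J
      · simp [keepRows, h]
      · simp [keepRows, h, hZ, hC i h]
    have hrank : (keepRows X Jᶜ * U).rank ≤ s := by
      rw [← keepRows_mul]
      exact (rank_keepRows_le _ _).trans hU
    have hA := h₁ E y (fun V hV => hy V (Finset.mem_union_left _ hV)) U hrank
    have hB := h₂ E y (fun V hV => hy V (Finset.mem_union_right _ hV)) Z
    rw [← hZc] at hA
    have hsplit := keepRows_add_keepRows_compl Z J
    have hsq : frobSq Z = frobSq (keepRows Z J) + frobSq (keepRows Z Jᶜ) := by
      conv_lhs => rw [← hsplit]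
      rw [frobSq_add, frobInner_keepRows_compl]
      ring
    have hle₁ : frobNorm (keepRows Z J) ≤ frobNorm Z :=
      Real.sqrt_le_sqrt (by linarith [frobSq_nonneg (keepRows Z Jᶜ)])
    have hle₂ : frobNorm (keepRows Z Jᶜ) ≤ frobNorm Z :=
      Real.sqrt_le_sqrt (by linarith [frobSq_nonneg (keepRows Z J)])
    have hin : frobInner E Z = frobInner E (keepRows Z J) + frobInner E (keepRows Z Jᶜ) := by
      conv_lhs => rw [← hsplit]
      rw [frobInner_add_right]
    rw [hin]
    nlinarith

/-! ### Exponential moments and uniform control of the noise -/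

/-- For `z ≥ u`, `z ^ 2 ≤ 2 u ^ 2 + 2 (z - u) ^ 2`, and the last square is dominated through `t ^ 2
/ 2 ≤ exp t`. This replaces tail integration: a second moment above a level is read off from the
moment generating function. -/
theorem sq_le_two_mul_sq_add_exp {u η : ℝ} (hη : 0 < η) (x : ℝ) :
    x ^ 2 ≤ 2 * u ^ 2 +
      4 / η ^ 2 * (Real.exp (η * (x - u)) + Real.exp (η * (-x - u))) := by
  have key : ∀ z : ℝ, u ≤ z → z ^ 2 ≤ 2 * u ^ 2 + 4 / η ^ 2 * Real.exp (η * (z - u)) := by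
    intro z hz
    have ht : 0 ≤ η * (z - u) := mul_nonneg hη.le (by linarith)
    have h1 := Real.quadratic_le_exp_of_nonneg ht
    have h2 : 2 * (z - u) ^ 2 = 4 / η ^ 2 * ((η * (z - u)) ^ 2 / 2) := by
      field_simp
      ring
    have h3 : 4 / η ^ 2 * ((η * (z - u)) ^ 2 / 2) ≤ 4 / η ^ 2 * Real.exp (η * (z - u)) :=
      mul_le_mul_of_nonneg_left (by linarith) (by positivity)
    nlinarith [sq_nonneg (z - 2 * u)]
  have hp : 0 ≤ 4 / η ^ 2 * Real.exp (η * (x - u)) := by positivity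
  have hm : 0 ≤ 4 / η ^ 2 * Real.exp (η * (-x - u)) := by positivity
  rw [mul_add]
  rcases le_or_gt u x with h | h
  · linarith [key x h]
  · rcases le_or_gt u (-x) with h' | h'
    · have := key (-x) h'
      rw [neg_sq] at this
      linarith
    · nlinarith [mul_pos (sub_pos.2 h) (by linarith : 0 < u + x)]

/-- The sum is `(1 + 1 / n) ^ n` by the binomial theorem. Weights `n ^ (-|J|)` therefore make a
union over all row sets affordable. -/
theorem sum_inv_pow_card_le_exp (n : ℕ) :
    ∑ J : Finset (Fin n), ((n : ℝ)⁻¹) ^ J.card ≤ Real.exp 1 := by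
  have h := Finset.sum_pow_mul_eq_add_pow ((n : ℝ)⁻¹) 1 (Finset.univ : Finset (Fin n))
  simp only [one_pow, mul_one, Finset.powerset_univ, Finset.card_univ, Fintype.card_fin] at h
  rw [h]
  calc ((n : ℝ)⁻¹ + 1) ^ n ≤ Real.exp ((n : ℝ)⁻¹) ^ n :=
        pow_le_pow_left₀ (by positivity) (Real.add_one_le_exp _) n
    _ = Real.exp (n * (n : ℝ)⁻¹) := (Real.exp_nat_mul _ n).symm
    _ ≤ Real.exp 1 := Real.exp_le_exp.2 mul_inv_le_one

theorem IsSubGaussianNoise.exp_mul_le {Ω : Type*} [MeasurableSpace Ω] {n m : ℕ} {μ : Measure Ω}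
    {σ : ℝ} {E : Ω → Matrix (Fin n) (Fin m) ℝ} (h : IsSubGaussianNoise μ σ E)
    {V : Matrix (Fin n) (Fin m) ℝ} (hV : frobSq V ≤ 1) (t : ℝ) :
    Integrable (fun ω => Real.exp (t * frobInner (E ω) V)) μ ∧
      ∫ ω, Real.exp (t * frobInner (E ω) V) ∂μ ≤ Real.exp (σ ^ 2 * t ^ 2 / 2) := by
  have heq : ∀ ω, ∑ i, ∑ j, (t • V) i j * E ω i j = t * frobInner (E ω) V := fun ω => by
    rw [frobInner_comm, frobInner, Finset.mul_sum]
    refine Finset.sum_congr rfl fun i _ => ?_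
    rw [Finset.mul_sum]
    exact Finset.sum_congr rfl fun j _ => by simp [mul_assoc]
  have h1 := h.2 (t • V)
  simp only [heq] at h1
  refine ⟨h1.1, h1.2.trans (Real.exp_le_exp.2 ?_)⟩
  rw [frobSq_smul]
  nlinarith [mul_le_mul_of_nonneg_left hV (mul_nonneg (sq_nonneg σ) (sq_nonneg t))]

/-- The exponential moments controlling the squares `frobInner E V ^ 2` beyond the level `u ^ 2`,
for `V` in a finite family of matrices. -/
noncomputable def expExcess {n m : ℕ} (N : Finset (Matrix (Fin n) (Fin m) ℝ)) (u η : ℝ)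
    (E : Matrix (Fin n) (Fin m) ℝ) : ℝ :=
  ∑ V ∈ N, 4 / η ^ 2 * (Real.exp (η * (frobInner E V - u)) + Real.exp (η * (-frobInner E V - u)))

theorem expExcess_nonneg {n m : ℕ} (N : Finset (Matrix (Fin n) (Fin m) ℝ)) (u η : ℝ)
    (E : Matrix (Fin n) (Fin m) ℝ) : 0 ≤ expExcess N u η E :=
  Finset.sum_nonneg fun _ _ => by positivity

theorem abs_frobInner_le_sqrt_expExcess {n m : ℕ} {N : Finset (Matrix (Fin n) (Fin m) ℝ)}
    {u η : ℝ} (hη : 0 < η) (E : Matrix (Fin n) (Fin m) ℝ)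
    {V : Matrix (Fin n) (Fin m) ℝ} (hV : V ∈ N) :
    |frobInner E V| ≤ Real.sqrt (2 * u ^ 2 + expExcess N u η E) := by
  refine Real.abs_le_sqrt ((sq_le_two_mul_sq_add_exp hη _).trans (add_le_add le_rfl ?_))
  exact Finset.single_le_sum (f := fun V => 4 / η ^ 2 * (Real.exp (η * (frobInner E V - u)) +
    Real.exp (η * (-frobInner E V - u)))) (fun _ _ => by positivity) hV

theorem IsSubGaussianNoise.expExcess_le {Ω : Type*} [MeasurableSpace Ω] {n m : ℕ} {μ : Measure Ω}
    {σ : ℝ} {E : Ω → Matrix (Fin n) (Fin m) ℝ} (h : IsSubGaussianNoise μ σ E)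
    {N : Finset (Matrix (Fin n) (Fin m) ℝ)} (hN : ∀ V ∈ N, frobSq V ≤ 1) (u η : ℝ) :
    Integrable (fun ω => expExcess N u η (E ω)) μ ∧
      ∫ ω, expExcess N u η (E ω) ∂μ ≤
        N.card * (8 / η ^ 2 * Real.exp (σ ^ 2 * η ^ 2 / 2 - η * u)) := by
  have hfac : ∀ (V : Matrix (Fin n) (Fin m) ℝ) ω,
      4 / η ^ 2 * (Real.exp (η * (frobInner (E ω) V - u)) +
        Real.exp (η * (-frobInner (E ω) V - u))) =
      4 / η ^ 2 * Real.exp (-(η * u)) * (Real.exp (η * frobInner (E ω) V) +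
        Real.exp (-η * frobInner (E ω) V)) := by
    intro V ω
    rw [mul_assoc, mul_add (Real.exp _), ← Real.exp_add, ← Real.exp_add]
    ring_nf
  simp only [expExcess, hfac]
  have hint : ∀ V ∈ N, Integrable (fun ω => 4 / η ^ 2 * Real.exp (-(η * u)) *
      (Real.exp (η * frobInner (E ω) V) + Real.exp (-η * frobInner (E ω) V))) μ := fun V hV =>
    ((h.exp_mul_le (hN V hV) η).1.add (h.exp_mul_le (hN V hV) (-η)).1).const_mul _
  refine ⟨integrable_finsetSum _ hint, ?_⟩
  rw [integral_finsetSum _ hint, ← nsmul_eq_mul]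
  refine Finset.sum_le_card_nsmul _ _ _ fun V hV => ?_
  rw [integral_const_mul, integral_add (h.exp_mul_le (hN V hV) η).1
    (h.exp_mul_le (hN V hV) (-η)).1]
  have h1 := (h.exp_mul_le (hN V hV) η).2
  have h2 := (h.exp_mul_le (hN V hV) (-η)).2
  rw [neg_sq] at h2
  calc _ ≤ 4 / η ^ 2 * Real.exp (-(η * u)) *
        (Real.exp (σ ^ 2 * η ^ 2 / 2) + Real.exp (σ ^ 2 * η ^ 2 / 2)) := by gcongr
    _ = _ := by
      rw [sub_eq_add_neg, Real.exp_add]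
      ring

/-- Uniform control of the noise on the sums of a matrix of rank at most `2 r` with columns in the
column space of `X` and a row-sparse matrix. -/
theorem exists_noise_bound {n m p : ℕ} (hn : 1 ≤ n) (X : Matrix (Fin n) (Fin p) ℝ) (r : ℕ)
    {σ : ℝ} (hσ : 0 < σ) :
    ∃ G : Matrix (Fin n) (Fin m) ℝ → ℝ,
      (∀ (E : Matrix (Fin n) (Fin m) ℝ) (J : Finset (Fin n)) (U : Matrix (Fin p) (Fin m) ℝ)
        (C : Matrix (Fin n) (Fin m) ℝ), (X * U).rank ≤ 2 * r → (∀ i ∉ J, C i = 0) →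
        frobInner E (X * U + C) ≤ frobSq (X * U + C) / 16 +
          2304 * σ ^ 2 * (1 + ((X.rank : ℝ) + m) * r + J.card * ((m : ℝ) + Real.log n)) + G E) ∧
      ∀ (Ω : Type*) [MeasurableSpace Ω] (μ : Measure Ω) (E : Ω → Matrix (Fin n) (Fin m) ℝ),
        IsSubGaussianNoise μ σ E →
        Integrable (fun ω => G (E ω)) μ ∧ ∫ ω, G (E ω) ∂μ ≤ 864 * σ ^ 2 := by
  choose N hcard hN hsup using exists_lowRank_add_rows_net m X (2 * r)
  have hlog : 0 ≤ Real.log n := Real.log_natCast_nonneg n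
  set b : Finset (Fin n) → ℝ := fun J =>
    1 + ((X.rank : ℝ) + m) * r + J.card * ((m : ℝ) + Real.log n) with hb
  have hb1 : ∀ J, 1 ≤ b J := fun J => by
    have h1 : 0 ≤ ((X.rank : ℝ) + m) * r := by positivity
    have h2 : 0 ≤ (J.card : ℝ) * ((m : ℝ) + Real.log n) := by positivity
    simp only [hb]
    linarith
  -- With `η = u / σ ^ 2`, the minimizer of `σ ^ 2 η ^ 2 / 2 - η u`, the exponent is `-u ^ 2 / (2 σ
  -- ^ 2) = -4 b J`, enough to beat the logarithm of the net size and leave `n ^ (-|J|)`.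
  set u : Finset (Fin n) → ℝ := fun J => Real.sqrt (8 * σ ^ 2 * b J) with hu
  have hu2 : ∀ J, u J ^ 2 = 8 * σ ^ 2 * b J := fun J =>
    Real.sq_sqrt (by have := hb1 J; positivity)
  have hu0 : ∀ J, 0 < u J := fun J => Real.sqrt_pos.2 (by have := hb1 J; positivity)
  have hη0 : ∀ J, 0 < u J / σ ^ 2 := fun J => div_pos (hu0 J) (by positivity)
  refine ⟨fun E => ∑ J, 144 * expExcess (N J) (u J) (u J / σ ^ 2) E,
    fun E J U C hU hC => ?_, fun Ω _ μ E hE => ?_⟩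
  · have h := hsup J E _ (Real.sqrt_nonneg _)
      (fun V hV => abs_frobInner_le_sqrt_expExcess (u := u J) (hη0 J) E hV) U C hU hC
    set y := Real.sqrt (2 * u J ^ 2 + expExcess (N J) (u J) (u J / σ ^ 2) E) with hy
    have hy2 : y ^ 2 = 2 * u J ^ 2 + expExcess (N J) (u J) (u J / σ ^ 2) E :=
      Real.sq_sqrt (by have := expExcess_nonneg (N J) (u J) (u J / σ ^ 2) E; positivity)
    have hG : 144 * expExcess (N J) (u J) (u J / σ ^ 2) E ≤
        ∑ J, 144 * expExcess (N J) (u J) (u J / σ ^ 2) E :=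
      Finset.single_le_sum (f := fun J => 144 * expExcess (N J) (u J) (u J / σ ^ 2) E)
        (fun J _ => mul_nonneg (by norm_num) (expExcess_nonneg _ _ _ _)) (Finset.mem_univ J)
    have hz := frobNorm_sq (X * U + C)
    -- Completing the square gives 144; with `2 * u J ^ 2 = 16 σ ^ 2 b J` this makes the constant
    -- 2304.
    have hq : 6 * y * frobNorm (X * U + C) ≤ frobNorm (X * U + C) ^ 2 / 16 + 144 * y ^ 2 := by
      nlinarith [sq_nonneg (frobNorm (X * U + C) / 4 - 12 * y)]
    rw [hz, hy2, hu2] at hq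
    show _ ≤ _ + 2304 * σ ^ 2 * b J + _
    linarith
  · have hJ := fun J => hE.expExcess_le (hN J) (u J) (u J / σ ^ 2)
    have hint : ∀ J ∈ Finset.univ, Integrable
        (fun ω => 144 * expExcess (N J) (u J) (u J / σ ^ 2) (E ω)) μ :=
      fun J _ => (hJ J).1.const_mul _
    refine ⟨integrable_finsetSum _ hint, ?_⟩
    rw [integral_finsetSum _ hint]
    have hterm : ∀ J : Finset (Fin n),
        ∫ ω, 144 * expExcess (N J) (u J) (u J / σ ^ 2) (E ω) ∂μ ≤
          288 * σ ^ 2 * ((n : ℝ)⁻¹) ^ J.card := by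
      intro J
      rw [integral_const_mul]
      have hexp : σ ^ 2 * (u J / σ ^ 2) ^ 2 / 2 - u J / σ ^ 2 * u J = -(4 * b J) := by
        have : σ ^ 2 * (u J / σ ^ 2) ^ 2 / 2 - u J / σ ^ 2 * u J = -(u J ^ 2) / (2 * σ ^ 2) := by
          field_simp
          ring
        rw [this, hu2]
        field_simp
        ring
      have hcoef : 8 / (u J / σ ^ 2) ^ 2 ≤ σ ^ 2 := by
        rw [div_pow, hu2, div_div_eq_mul_div, div_le_iff₀ (by have := hb1 J; positivity)]
        nlinarith [mul_le_mul_of_nonneg_left (hb1 J) (by positivity : 0 ≤ 8 * σ ^ 2 * σ ^ 2)]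
      have hcard' : ((N J).card : ℝ) ≤
          2 * Real.exp (4 * (((X.rank : ℝ) + m) * r) + 2 * (J.card * (m : ℝ))) := by
        have h1 : ((N J).card : ℝ) ≤
            2 * (5 : ℝ) ^ ((X.rank + m) * (2 * r) + J.card * m) := by exact_mod_cast hcard J
        -- Trading 5 for `exp 2` doubles the exponents of the net size, which `4 * b J` still
        -- dominates.
        have h5 : (5 : ℝ) ≤ Real.exp 2 := by
          have := Real.quadratic_le_exp_of_nonneg (by norm_num : (0 : ℝ) ≤ 2)
          linarith
        refine h1.trans (mul_le_mul_of_nonneg_left ?_ (by norm_num))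
        refine (pow_le_pow_left₀ (by norm_num) h5 _).trans (le_of_eq ?_)
        rw [← Real.exp_nat_mul]
        push_cast
        ring_nf
      have hpow : ((n : ℝ)⁻¹) ^ J.card = Real.exp (-(J.card * Real.log n)) := by
        rw [inv_pow, ← Real.exp_log (by positivity : (0 : ℝ) < (n : ℝ) ^ J.card), ← Real.exp_neg,
          Real.log_pow]
      have hfin : Real.exp (4 * (((X.rank : ℝ) + m) * r) + 2 * (J.card * (m : ℝ))) *
          Real.exp (-(4 * b J)) ≤ ((n : ℝ)⁻¹) ^ J.card := by
        rw [hpow, ← Real.exp_add]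
        refine Real.exp_le_exp.2 ?_
        have h1 : 0 ≤ (J.card : ℝ) * m := by positivity
        have h2 : 0 ≤ (J.card : ℝ) * Real.log n := by positivity
        simp only [hb]
        nlinarith
      have hmain := (hJ J).2
      rw [hexp] at hmain
      calc 144 * ∫ ω, expExcess (N J) (u J) (u J / σ ^ 2) (E ω) ∂μ
          ≤ 144 * (2 * Real.exp (4 * (((X.rank : ℝ) + m) * r) + 2 * (J.card * (m : ℝ))) *
              (σ ^ 2 * Real.exp (-(4 * b J)))) := by
            refine mul_le_mul_of_nonneg_left (hmain.trans ?_) (by norm_num)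
            gcongr
        _ = 288 * σ ^ 2 * (Real.exp (4 * (((X.rank : ℝ) + m) * r) + 2 * (J.card * (m : ℝ))) *
              Real.exp (-(4 * b J))) := by ring
        _ ≤ _ := by gcongr
    refine (Finset.sum_le_sum fun J _ => hterm J).trans ?_
    rw [← Finset.mul_sum]
    have he : Real.exp 1 ≤ 3 := Real.exp_one_lt_d9.le.trans (by norm_num)
    have := (sum_inv_pow_card_le_exp n).trans he
    nlinarith [mul_le_mul_of_nonneg_left this (by positivity : 0 ≤ 288 * σ ^ 2)]

/-! ### Projections, row supports and the group norm -/

theorem frobInner_eq_trace {n m : ℕ} (A B : Matrix (Fin n) (Fin m) ℝ) :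
    frobInner A B = (A.transpose * B).trace := by
  simp only [frobInner, Matrix.trace, Matrix.diag, Matrix.mul_apply, Matrix.transpose_apply]
  exact Finset.sum_comm

theorem frobInner_mul_left {n m k : ℕ} (P : Matrix (Fin n) (Fin k) ℝ)
    (A : Matrix (Fin k) (Fin m) ℝ) (B : Matrix (Fin n) (Fin m) ℝ) :
    frobInner (P * A) B = frobInner A (P.transpose * B) := by
  rw [frobInner_eq_trace, frobInner_eq_trace, Matrix.transpose_mul, Matrix.mul_assoc]

theorem frobSq_eq_add_of_isStarProjection {n m : ℕ} {P : Matrix (Fin n) (Fin n) ℝ}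
    (hP : IsStarProjection P) (A : Matrix (Fin n) (Fin m) ℝ) :
    frobSq A = frobSq (P * A) + frobSq ((1 - P) * A) := by
  have hT : P.transpose = P := by
    rw [← Matrix.conjTranspose_eq_transpose_of_trivial]
    exact hP.isSelfAdjoint.star_eq
  have h0 : frobInner (P * A) ((1 - P) * A) = 0 := by
    rw [frobInner_mul_left, hT, ← Matrix.mul_assoc, mul_sub, mul_one, hP.isIdempotentElem.eq,
      sub_self, Matrix.zero_mul]
    simp [frobInner]
  have hA : A = P * A + (1 - P) * A := by rw [← Matrix.add_mul, add_sub_cancel, Matrix.one_mul]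
  conv_lhs => rw [hA]
  rw [frobSq_add, h0]
  ring

theorem rowNorm_eq_norm {n m : ℕ} (A : Matrix (Fin n) (Fin m) ℝ) (i : Fin n) :
    rowNorm A i = ‖WithLp.toLp 2 (A i)‖ := by
  simp [rowNorm, EuclideanSpace.norm_eq]

theorem rowNorm_eq_zero_iff {n m : ℕ} (A : Matrix (Fin n) (Fin m) ℝ) (i : Fin n) :
    rowNorm A i = 0 ↔ A i = 0 := by
  rw [rowNorm_eq_norm, norm_eq_zero, WithLp.toLp_eq_zero]

theorem mem_rowSupport {n m : ℕ} {A : Matrix (Fin n) (Fin m) ℝ} {i : Fin n} :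
    i ∈ rowSupport A ↔ A i ≠ 0 := by
  simp [rowSupport]

/-- Passing from `C` to `D` decreases the group norm by at most `‖Δ_J‖ - ‖Δ_{Jᶜ}‖`, where
`Δ = D - C` and `J` is the row support of `C`. -/
theorem groupNormOn_sub_le {n m : ℕ} (C D : Matrix (Fin n) (Fin m) ℝ) :
    groupNormOn Finset.univ C - groupNormOn Finset.univ D ≤
      groupNormOn (rowSupport C) (D - C) - groupNormOn (rowSupport C)ᶜ (D - C) := by
  simp only [groupNormOn]
  rw [← Finset.sum_sub_distrib, ← Finset.sum_add_sum_compl (rowSupport C), sub_eq_add_neg,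
    ← Finset.sum_neg_distrib]
  refine add_le_add (Finset.sum_le_sum fun i _ => ?_) (Finset.sum_le_sum fun i hi => ?_)
  · simp only [rowNorm_eq_norm]
    have : WithLp.toLp 2 ((D - C) i) = WithLp.toLp 2 (D i) - WithLp.toLp 2 (C i) := rfl
    rw [this, norm_sub_rev]
    exact norm_sub_norm_le _ _
  · have hC : C i = 0 := by simpa [mem_rowSupport] using hi
    have hD : (D - C) i = D i := by
      funext j
      have := congrFun hC j
      simp_all
    have h0 : rowNorm C i = 0 := (rowNorm_eq_zero_iff C i).2 hC
    rw [h0, rowNorm_eq_norm, rowNorm_eq_norm, hD, zero_sub]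

/-- A concave quadratic functional which is bounded in terms of the number of nonzero rows is
bounded in terms of the group norm. -/
theorem le_groupNorm_of_le_card {n m : ℕ} {E : Matrix (Fin n) (Fin m) ℝ}
    {Q : Matrix (Fin n) (Fin n) ℝ}
    (hQ : ∀ C : Matrix (Fin n) (Fin m) ℝ, frobSq (Q * C) ≤ frobSq C) {κ R t : ℝ} (hκ : 0 ≤ κ)
    (ht : 0 < t)
    (h : ∀ C : Matrix (Fin n) (Fin m) ℝ,
      frobInner E (Q * C) - frobSq (Q * C) / 16 ≤ R + κ * (rowSupport C).card)
    (C : Matrix (Fin n) (Fin m) ℝ) :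
    frobInner E (Q * C) - frobSq (Q * C) / 16 ≤
      R + (κ / t + t / 16) * groupNormOn Finset.univ C := by
  classical
  -- Rows are moved one at a time from the count to the group norm: those in `s` are already charged
  -- by their norm, the others still cost `κ` each.
  suffices H : ∀ (s : Finset (Fin n)) (C : Matrix (Fin n) (Fin m) ℝ),
      frobInner E (Q * C) - frobSq (Q * C) / 16 ≤
        R + (κ / t + t / 16) * groupNormOn s C + κ * (rowSupport C \ s).card by
    have h1 := H Finset.univ C
    rwa [Finset.sdiff_eq_empty_iff_subset.2 (Finset.subset_univ _), Finset.card_empty,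
      Nat.cast_zero, mul_zero, add_zero] at h1
  intro s
  induction s using Finset.induction_on with
  | empty => intro C; simpa [groupNormOn] using h C
  | insert i s hi ih =>
    intro C
    have hsum : groupNormOn (insert i s) C = rowNorm C i + groupNormOn s C :=
      Finset.sum_insert hi
    have hν := rowNorm_nonneg C i
    rw [hsum]
    rcases eq_or_lt_of_le hν with h0 | hpos
    · have hset : rowSupport C \ s = rowSupport C \ insert i s := by
        have hi0 : i ∉ rowSupport C := by
          simpa [mem_rowSupport] using (rowNorm_eq_zero_iff C i).1 h0.symm
        rw [Finset.sdiff_insert, Finset.erase_eq_of_notMem (by simp [hi0])]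
      rw [← h0, zero_add, ← hset]
      exact ih C
    have hdiff : rowSupport C \ s = insert i (rowSupport C \ insert i s) := by
      have hi1 : i ∈ rowSupport C := by
        rw [mem_rowSupport, Ne, ← rowNorm_eq_zero_iff]
        exact hpos.ne'
      rw [Finset.sdiff_insert, Finset.insert_erase (by simp [hi1, hi])]
    set k := (rowSupport C \ insert i s).card with hk
    have hcard : (rowSupport C \ s).card = k + 1 := by
      rw [hdiff, Finset.card_insert_of_notMem (by simp)]
    set ν := rowNorm C i with hνdef
    rcases le_or_gt t ν with hbig | hsmall
    · have h1 := ih C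
      rw [hcard] at h1
      push_cast at h1
      have h2 : κ ≤ κ / t * ν := by
        rw [div_mul_eq_mul_div, le_div_iff₀ ht]
        exact mul_le_mul_of_nonneg_left hbig hκ
      have h3 : 0 ≤ t / 16 * ν := by positivity
      nlinarith
    -- A row of norm `ν < t` is the mixture, with weight `w = ν / t`, of a zero row and a row of
    -- norm `t`. The induction hypothesis at the two endpoints costs `κ w` on average for this row.
    · set D : Matrix (Fin n) (Fin m) ℝ := Matrix.updateRow 0 i ((t / ν) • C i) with hD
      set C₀ := C.updateRow i 0 with hC₀
      set w := ν / t with hw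
      have hCw : C = C₀ + w • D := by
        ext a j
        by_cases ha : a = i
        · subst ha
          simp only [hC₀, hD, Matrix.add_apply, Matrix.smul_apply, Matrix.updateRow_self,
            Pi.zero_apply, Pi.smul_apply, smul_eq_mul, hw]
          field_simp
          ring
        · simp [hC₀, hD, ha]
      have hDsq : frobSq D = t ^ 2 := by
        rw [frobSq, Finset.sum_eq_single i (fun a _ ha => by simp [hD, ha]) (by simp)]
        simp only [hD, Matrix.updateRow_self, Pi.smul_apply, smul_eq_mul, mul_pow]
        rw [← Finset.mul_sum, ← rowNorm_sq, ← hνdef]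
        field_simp
      have hrow : ∀ C' : Matrix (Fin n) (Fin m) ℝ, (∀ a, a ≠ i → C' a = C a) →
          groupNormOn s C' = groupNormOn s C := fun C' hC' =>
        Finset.sum_congr rfl fun a ha => by
          rw [rowNorm, rowNorm, hC' a (fun hai => hi (hai ▸ ha))]
      have hsupp : ∀ C' : Matrix (Fin n) (Fin m) ℝ, (∀ a, a ≠ i → C' a = C a) →
          rowSupport C' \ s ⊆ insert i (rowSupport C \ insert i s) := fun C' hC' a ha => by
        by_cases hai : a = i
        · simp [hai]
        · rw [Finset.mem_sdiff, mem_rowSupport, hC' a hai] at ha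
          simp [hai, ha.2, mem_rowSupport, ha.1]
      have hr₀ : ∀ a, a ≠ i → C₀ a = C a := fun a ha => by
        funext j
        simp [hC₀, ha]
      have hr₁ : ∀ a, a ≠ i → (C₀ + D) a = C a := fun a ha => by
        funext j
        simp [hC₀, hD, ha]
      have hk₀ : (rowSupport C₀ \ s).card ≤ k := by
        refine Finset.card_le_card fun a ha => ?_
        rcases Finset.mem_insert.1 (hsupp C₀ hr₀ ha) with rfl | h'
        · exact absurd (Finset.mem_sdiff.1 ha).1 (by
            rw [mem_rowSupport, not_not]
            funext j
            simp [hC₀])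
        · exact h'
      have hk₁ : (rowSupport (C₀ + D) \ s).card ≤ k + 1 :=
        (Finset.card_le_card (hsupp _ hr₁)).trans (Finset.card_insert_le _ _)
      have hk₀' : ((rowSupport C₀ \ s).card : ℝ) ≤ k := by exact_mod_cast hk₀
      have hk₁' : ((rowSupport (C₀ + D) \ s).card : ℝ) ≤ k + 1 := by exact_mod_cast hk₁
      have i₀ := (ih C₀).trans (add_le_add le_rfl (mul_le_mul_of_nonneg_left hk₀' hκ))
      have i₁ := (ih (C₀ + D)).trans (add_le_add le_rfl (mul_le_mul_of_nonneg_left hk₁' hκ))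
      rw [hrow _ hr₀] at i₀
      rw [hrow _ hr₁, Matrix.mul_add, frobInner_add_right, frobSq_add] at i₁
      have hY : frobSq (Q * D) ≤ t ^ 2 := (hQ D).trans_eq hDsq
      have hw0 : 0 ≤ w := by positivity
      have hw1 : w ≤ 1 := (div_le_one ht).2 hsmall.le
      have hνw : ν = w * t := by rw [hw]; field_simp
      have hlam : (κ / t + t / 16) * (ν + groupNormOn s C) =
          w * (κ + t ^ 2 / 16) + (κ / t + t / 16) * groupNormOn s C := by
        rw [mul_add, hνw]
        congr 1
        field_simp
      rw [hlam]
      conv_lhs => rw [hCw]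
      rw [Matrix.mul_add, Matrix.mul_smul, frobInner_add_right, frobInner_smul_right, frobSq_add,
        frobInner_smul_right, frobSq_smul]
      have c₀ := mul_le_mul_of_nonneg_left i₀ (by linarith : 0 ≤ 1 - w)
      have c₁ := mul_le_mul_of_nonneg_left i₁ hw0
      -- Concavity makes the value at the mixture exceed the interpolated one by exactly `w (1 - w)
      -- ‖Q D‖² / 16`; this defect produces the term `t / 16` in the slope.
      have c₂ : w * (1 - w) * frobSq (Q * D) ≤ w * t ^ 2 := by
        have := frobSq_nonneg (Q * D)
        have h1 : w * (1 - w) ≤ w := by nlinarith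
        calc w * (1 - w) * frobSq (Q * D) ≤ w * frobSq (Q * D) :=
              mul_le_mul_of_nonneg_right h1 this
          _ ≤ w * t ^ 2 := mul_le_mul_of_nonneg_left hY hw0
      linarith

/-! ### Column spaces and the deterministic oracle inequality -/

/-- The orthogonal projection onto the column space of a matrix. -/
theorem exists_isStarProjection_range {n m : ℕ} (M : Matrix (Fin n) (Fin m) ℝ) :
    ∃ P : Matrix (Fin n) (Fin n) ℝ, IsStarProjection P ∧ P * M = M ∧
      LinearMap.range P.mulVecLin ≤ LinearMap.range M.mulVecLin := by
  let L := (WithLp.linearEquiv 2 ℝ (Fin n → ℝ)).symm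
  let S : Submodule ℝ (EuclideanSpace ℝ (Fin n)) :=
    (LinearMap.range M.mulVecLin).map L.toLinearMap
  let Φ := Matrix.toEuclideanCLM (n := Fin n) (𝕜 := ℝ)
  let P := Φ.symm S.starProjection
  have hΦ : Φ P = S.starProjection := Φ.apply_symm_apply _
  have hmul : ∀ x : Fin n → ℝ, WithLp.toLp 2 (P.mulVec x) = S.starProjection (WithLp.toLp 2 x) := by
    intro x
    rw [← hΦ]
    exact (Matrix.toEuclideanCLM_toLp P x).symm
  refine ⟨P, ?_, ?_, ?_⟩
  · have hproj := isStarProjection_starProjection (U := S)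
    refine ⟨Φ.injective ?_, Φ.injective ?_⟩
    · change Φ (P * P) = Φ P
      rw [map_mul, hΦ]
      exact hproj.isIdempotentElem
    · change Φ (star P) = Φ P
      rw [map_star, hΦ]
      exact hproj.isSelfAdjoint
  · ext i j
    have hmem : WithLp.toLp 2 (M.col j) ∈ S :=
      ⟨M.col j, ⟨Pi.single j 1, by simp⟩, rfl⟩
    have h := hmul (M.col j)
    rw [Submodule.starProjection_eq_self_iff.2 hmem] at h
    exact congrFun (congrArg WithLp.ofLp h) i
  · rintro _ ⟨x, rfl⟩
    have h : WithLp.toLp 2 (P.mulVec x) ∈ S := by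
      rw [hmul]
      exact S.starProjection_apply_mem _
    obtain ⟨z, hz, hzx⟩ := h
    have : z = P.mulVec x := congrArg WithLp.ofLp hzx
    rw [Matrix.mulVecLin_apply, ← this]
    exact hz

/-- Writing a projection as `P = X T` puts `(1 - P) C'` in the form `X U + C'` covered by the noise
bound. -/
theorem Matrix.exists_eq_mul_of_range_le {n p k : ℕ} {X : Matrix (Fin n) (Fin p) ℝ}
    {P : Matrix (Fin n) (Fin k) ℝ}
    (h : LinearMap.range P.mulVecLin ≤ LinearMap.range X.mulVecLin) :
    ∃ T : Matrix (Fin p) (Fin k) ℝ, P = X * T := by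
  have h1 : ∀ j, ∃ v, X.mulVec v = P.col j := fun j => by
    obtain ⟨v, hv⟩ := h ⟨Pi.single j 1, rfl⟩
    exact ⟨v, by simpa using hv⟩
  choose v hv using h1
  refine ⟨Matrix.of fun a j => v j a, ?_⟩
  ext i j
  exact (congrFun (hv j) i).symm

theorem Matrix.rank_sub_le {n m : ℕ} (A B : Matrix (Fin n) (Fin m) ℝ) :
    (A - B).rank ≤ A.rank + B.rank := by
  have h : LinearMap.range (A - B).mulVecLin ≤
      LinearMap.range A.mulVecLin ⊔ LinearMap.range B.mulVecLin := by
    rintro _ ⟨x, rfl⟩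
    rw [Matrix.mulVecLin_apply, Matrix.sub_mulVec]
    exact Submodule.sub_mem _ (Submodule.mem_sup_left ⟨x, rfl⟩) (Submodule.mem_sup_right ⟨x, rfl⟩)
  exact (Submodule.finrank_mono h).trans (Submodule.finrank_add_le_finrank_add_finrank _ _)

theorem objective_eq {n m p : ℕ} (X : Matrix (Fin n) (Fin p) ℝ)
    (Bstar : Matrix (Fin p) (Fin m) ℝ) (Cstar E : Matrix (Fin n) (Fin m) ℝ) (lam : ℝ)
    (B : Matrix (Fin p) (Fin m) ℝ) (C : Matrix (Fin n) (Fin m) ℝ) :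
    objective X (X * Bstar + Cstar + E) lam B C =
      frobSq E / 2 - frobInner E (X * (B - Bstar) + (C - Cstar)) +
        predLoss X (B - Bstar) (C - Cstar) / 2 + lam * groupNormOn Finset.univ C := by
  have h : X * Bstar + Cstar + E - X * B - C =
      E + (-1 : ℝ) • (X * (B - Bstar) + (C - Cstar)) := by
    rw [Matrix.mul_sub, neg_one_smul]
    abel
  rw [objective, h, frobSq_add, frobInner_smul_right, frobSq_smul, predLoss]
  ring

/-- The deterministic oracle inequality for the rank-constrained minimizer, on the event where the
noise is controlled. -/
theorem IsRankConstrainedMinimizer.predLoss_le {n m p r : ℕ} {X : Matrix (Fin n) (Fin p) ℝ}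
    {Bstar : Matrix (Fin p) (Fin m) ℝ} {Cstar E : Matrix (Fin n) (Fin m) ℝ} {lam τ R ϑ K : ℝ}
    (hτ : 0 < τ) (hϑ : 0 < ϑ) (hK : 0 ≤ K) (hlam : 24 * τ * (2 + ϑ) ≤ ϑ * lam)
    (hnoise : ∀ (J : Finset (Fin n)) (U : Matrix (Fin p) (Fin m) ℝ)
      (C : Matrix (Fin n) (Fin m) ℝ), (X * U).rank ≤ 2 * r → (∀ i ∉ J, C i = 0) →
      frobInner E (X * U + C) ≤ frobSq (X * U + C) / 16 + R + 2304 * τ ^ 2 * J.card)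
    {Bhat : Matrix (Fin p) (Fin m) ℝ} {Chat : Matrix (Fin n) (Fin m) ℝ}
    (hmin : IsRankConstrainedMinimizer X (X * Bstar + Cstar + E) lam r Bhat Chat)
    {B : Matrix (Fin p) (Fin m) ℝ} {C : Matrix (Fin n) (Fin m) ℝ} (hB : B.rank ≤ r)
    (hinc : Incoherence m X r (rowSupport C) K ϑ) :
    predLoss X (Bhat - Bstar) (Chat - Cstar) ≤ 3 * predLoss X (B - Bstar) (C - Cstar) + 8 * R +
      16 * lam ^ 2 * K ^ 2 * (rowSupport C).card := by
  set Δ := Chat - C with hΔ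
  set D := X * (Bhat - B) + Δ with hD
  have hrank : (X * (Bhat - B)).rank ≤ 2 * r := by
    refine (Matrix.rank_mul_le_right _ _).trans ?_
    have h1 := Matrix.rank_sub_le Bhat B
    have h2 := hmin.1
    omega
  obtain ⟨P, hP, hPM, hPrange⟩ := exists_isStarProjection_range (X * (Bhat - B))
  have hPX : LinearMap.range P.mulVecLin ≤ LinearMap.range X.mulVecLin := by
    refine hPrange.trans ?_
    rw [Matrix.mulVecLin_mul]
    exact LinearMap.range_comp_le_range _ _
  have hPrank : P.rank ≤ 2 * r := (Submodule.finrank_mono hPrange).trans hrank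
  obtain ⟨T, hT⟩ := Matrix.exists_eq_mul_of_range_le hPX
  have hQD : (1 - P) * D = (1 - P) * Δ := by
    rw [hD, Matrix.mul_add, Matrix.sub_mul, Matrix.one_mul, hPM, sub_self, zero_add]
  have hPD : frobInner E (P * D) ≤ frobSq (P * D) / 16 + R := by
    have heq : X * (T * D) = P * D := by rw [← Matrix.mul_assoc, ← hT]
    have := hnoise ∅ (T * D) 0 (by rw [heq]; exact (Matrix.rank_mul_le_left _ _).trans hPrank)
      (fun _ _ => rfl)
    simpa [heq] using this
  have hcard : ∀ C' : Matrix (Fin n) (Fin m) ℝ,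
      frobInner E ((1 - P) * C') - frobSq ((1 - P) * C') / 16 ≤
        R + 2304 * τ ^ 2 * (rowSupport C').card := by
    intro C'
    have heq : X * (-(T * C')) + C' = (1 - P) * C' := by
      rw [Matrix.mul_neg, ← Matrix.mul_assoc, ← hT, Matrix.sub_mul, Matrix.one_mul]
      abel
    have hr : (X * (-(T * C'))).rank ≤ 2 * r := by
      rw [Matrix.mul_neg, ← Matrix.mul_assoc, ← hT, ← Matrix.mul_neg]
      exact (Matrix.rank_mul_le_left _ _).trans hPrank
    have := hnoise (rowSupport C') (-(T * C')) C' hr (fun i hi => by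
      simpa [mem_rowSupport] using hi)
    rw [heq] at this
    linarith
  have hcontr : ∀ C' : Matrix (Fin n) (Fin m) ℝ, frobSq ((1 - P) * C') ≤ frobSq C' := fun C' => by
    rw [frobSq_eq_add_of_isStarProjection hP C']
    linarith [frobSq_nonneg (P * C')]
  -- The threshold `192 τ` balances the two parts of the slope, each equal to `12 τ`.
  have hsp := le_groupNorm_of_le_card hcontr (by positivity) (by positivity : 0 < 192 * τ) hcard Δ
  have hslope : 2304 * τ ^ 2 / (192 * τ) + 192 * τ / 16 = 24 * τ := by
    field_simp
    norm_num
  rw [hslope] at hsp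
  have hJ : groupNormOn Finset.univ Δ =
      groupNormOn (rowSupport C) Δ + groupNormOn (rowSupport C)ᶜ Δ :=
    (Finset.sum_add_sum_compl _ _).symm
  have hg₁ : 0 ≤ groupNormOn (rowSupport C) Δ := Finset.sum_nonneg fun i _ => rowNorm_nonneg _ i
  have hg₂ : 0 ≤ groupNormOn (rowSupport C)ᶜ Δ := Finset.sum_nonneg fun i _ => rowNorm_nonneg _ i
  have hpen := groupNormOn_sub_le C Chat
  rw [← hΔ] at hpen
  have hI := hinc Δ P hP hPX hPrank
  have hopt := hmin.2 B C hB
  rw [objective_eq, objective_eq] at hopt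
  set Z := X * (B - Bstar) + (C - Cstar) with hZ
  set Zhat := X * (Bhat - Bstar) + (Chat - Cstar) with hZhat
  have hDZ : Zhat = Z + D := by
    rw [hZhat, hZ, hD, hΔ, Matrix.mul_sub, Matrix.mul_sub, Matrix.mul_sub]
    abel
  have hED : frobInner E Zhat = frobInner E Z + frobInner E (P * D) +
      frobInner E ((1 - P) * Δ) := by
    have hsplit : P * D + (1 - P) * D = D := by
      rw [← Matrix.add_mul, add_sub_cancel, Matrix.one_mul]
    rw [hDZ, frobInner_add_right, ← hQD, add_assoc, ← frobInner_add_right E (P * D), hsplit]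
  have hDsq := frobSq_eq_add_of_isStarProjection hP D
  rw [hQD] at hDsq
  have hDle : frobSq D ≤ 2 * frobSq Zhat + 2 * frobSq Z := by
    have h1 : D = Zhat + (-1 : ℝ) • Z := by rw [hDZ, neg_one_smul]; abel
    have h2 := frobSq_nonneg (Zhat + Z)
    rw [frobSq_add] at h2
    rw [h1, frobSq_add, frobInner_smul_right, frobSq_smul]
    linarith
  have hMhat : predLoss X (Bhat - Bstar) (Chat - Cstar) = frobSq Zhat := rfl
  have hM : predLoss X (B - Bstar) (C - Cstar) = frobSq Z := rfl
  rw [hMhat, hM] at hopt ⊢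
  set a := groupNormOn (rowSupport C) Δ
  set b := groupNormOn (rowSupport C)ᶜ Δ
  set z := frobNorm ((1 - P) * Δ) with hz
  set k := Real.sqrt ((rowSupport C).card : ℝ) with hk
  have hk2 : k ^ 2 = (rowSupport C).card := Real.sq_sqrt (by positivity)
  have hz2 : z ^ 2 = frobSq ((1 - P) * Δ) := frobNorm_sq _
  have hz0 : 0 ≤ z := frobNorm_nonneg _
  have hk0 : 0 ≤ k := Real.sqrt_nonneg _
  have hlam' : 24 * τ ≤ lam := by nlinarith
  have hlam0 : 0 ≤ lam - 24 * τ := by linarith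
  -- Comparing coefficients of `a`, the first bound below requires `lam + 24 τ ≤ (lam - 24 τ) (1 +
  -- ϑ)`, which is exactly `hlam`.
  have hgroup : 24 * τ * (a + b) + lam * (a - b) ≤ lam * (K * k * z) := by
    have h1 : 24 * τ * (a + b) + lam * (a - b) ≤ (lam - 24 * τ) * ((1 + ϑ) * a - b) := by
      have := mul_le_mul_of_nonneg_right hlam hg₁
      linarith
    have h2 : (lam - 24 * τ) * ((1 + ϑ) * a - b) ≤ (lam - 24 * τ) * (K * k * z) :=
      mul_le_mul_of_nonneg_left (by linarith) hlam0
    have h3 : 0 ≤ τ * (K * k * z) := by positivity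
    linarith
  have hyoung : lam * (K * k * z) ≤ z ^ 2 / 16 + 4 * lam ^ 2 * K ^ 2 * k ^ 2 := by
    have := sq_nonneg (z / 4 - 2 * (lam * K * k))
    linarith
  have hlampen := mul_le_mul_of_nonneg_left hpen (by linarith : 0 ≤ lam)
  rw [hED] at hopt
  rw [← hk2]
  rw [← hz2] at hDsq hsp
  rw [hJ] at hsp
  have hPDn := frobSq_nonneg (P * D)
  -- The noise and Young terms contribute at most `‖D‖² / 8 ≤ (‖Zhat‖² + ‖Z‖²) / 4`, half of which
  -- is absorbed by the `‖Zhat‖² / 2` on the left; multiplying by 4 gives the constants.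
  linarith

/-! ### Integrability and the bound in expectation -/

theorem aestronglyMeasurable_predLoss {Ω : Type*} [MeasurableSpace Ω] {μ : Measure Ω}
    {n m p : ℕ} (X : Matrix (Fin n) (Fin p) ℝ) (Bstar : Matrix (Fin p) (Fin m) ℝ)
    (Cstar : Matrix (Fin n) (Fin m) ℝ) {Bhat : Ω → Matrix (Fin p) (Fin m) ℝ}
    {Chat : Ω → Matrix (Fin n) (Fin m) ℝ} (hB : ∀ i j, AEMeasurable (fun ω => Bhat ω i j) μ)
    (hC : ∀ i j, AEMeasurable (fun ω => Chat ω i j) μ) :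
    AEStronglyMeasurable (fun ω => predLoss X (Bhat ω - Bstar) (Chat ω - Cstar)) μ := by
  refine AEMeasurable.aestronglyMeasurable ?_
  simp only [predLoss, frobSq, Matrix.add_apply, Matrix.mul_apply, Matrix.sub_apply]
  refine Finset.aemeasurable_fun_sum _ fun i _ => Finset.aemeasurable_fun_sum _ fun j _ => ?_
  refine AEMeasurable.pow_const (AEMeasurable.add ?_ ((hC i j).sub_const _)) 2
  exact Finset.aemeasurable_fun_sum _ fun k _ => ((hB k j).sub_const _).const_mul _

theorem frobSq_eq_zero_of_isEmpty {n m : ℕ} (h : n = 0 ∨ m = 0)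
    (A : Matrix (Fin n) (Fin m) ℝ) : frobSq A = 0 := by
  rcases h with rfl | rfl <;> simp [frobSq]

theorem theorem6 (ϑ : ℝ) (hϑ : 0 < ϑ) :
    ∃ A₀ : ℝ, 0 < A₀ ∧ ∀ A : ℝ, A₀ ≤ A → ∃ c : ℝ, 0 < c ∧
      ∀ (n m p r : ℕ) (σ : ℝ), 0 < σ →
      ∀ (X : Matrix (Fin n) (Fin p) ℝ)
        (Bstar : Matrix (Fin p) (Fin m) ℝ) (Cstar : Matrix (Fin n) (Fin m) ℝ)
        (Ω : Type*) [MeasurableSpace Ω] (μ : Measure Ω) [IsProbabilityMeasure μ]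
        (E : Ω → Matrix (Fin n) (Fin m) ℝ), IsSubGaussianNoise μ σ E →
      ∀ (Bhat : Ω → Matrix (Fin p) (Fin m) ℝ) (Chat : Ω → Matrix (Fin n) (Fin m) ℝ),
        (∀ i j, AEMeasurable (fun ω => Bhat ω i j) μ) →
        (∀ i j, AEMeasurable (fun ω => Chat ω i j) μ) →
        (∀ᵐ ω ∂μ, IsRankConstrainedMinimizer X (X * Bstar + Cstar + E ω)
          (A * σ * Real.sqrt ((m : ℝ) + Real.log n)) r (Bhat ω) (Chat ω)) →
      ∀ (B : Matrix (Fin p) (Fin m) ℝ) (C : Matrix (Fin n) (Fin m) ℝ) (K : ℝ),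
        B.rank ≤ r → 0 ≤ K → Incoherence m X r (rowSupport C) K ϑ →
        Integrable (fun ω => predLoss X (Bhat ω - Bstar) (Chat ω - Cstar)) μ ∧
        ∫ ω, predLoss X (Bhat ω - Bstar) (Chat ω - Cstar) ∂μ ≤
          c * (predLoss X (B - Bstar) (C - Cstar) + σ ^ 2
            + σ ^ 2 * ((X.rank : ℝ) + m) * r
            + σ ^ 2 * K ^ 2 * ((rowSupport C).card : ℝ) * ((m : ℝ) + Real.log n)) := by
  -- `A₀` is the least `A` with `24 (2 + ϑ) ≤ ϑ A`. In `c`, `25344 = 8 * 2304 + 8 * 864` collects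
  -- the level of the noise bound and the mean of `G`; `16 A ^ 2` comes from `lam ^ 2`.
  refine ⟨24 * (2 + ϑ) / ϑ, by positivity, fun A hA => ⟨25344 + 16 * A ^ 2, by positivity, ?_⟩⟩
  intro n m p r σ hσ X Bstar Cstar Ω _ μ _ E hE Bhat Chat hBm hCm hmin B C K hB hK hinc
  have hlog : 0 ≤ Real.log n := Real.log_natCast_nonneg n
  have hM0 : 0 ≤ predLoss X (B - Bstar) (C - Cstar) := frobSq_nonneg _
  have hR0 : 0 ≤ σ ^ 2 * ((X.rank : ℝ) + m) * r := by positivity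
  have hJ0 : 0 ≤ σ ^ 2 * K ^ 2 * ((rowSupport C).card : ℝ) * ((m : ℝ) + Real.log n) := by
    positivity
  have hσ2 : 0 < σ ^ 2 := by positivity
  -- For empty matrices the loss vanishes; otherwise `m ≥ 1` ensures `τ > 0`.
  by_cases hempty : n = 0 ∨ m = 0
  · simp only [predLoss, frobSq_eq_zero_of_isEmpty hempty] at hM0 ⊢
    refine ⟨integrable_zero _ _ _, ?_⟩
    rw [integral_zero]
    positivity
  push Not at hempty
  have hn : 1 ≤ n := Nat.one_le_iff_ne_zero.2 hempty.1
  have hm : (1 : ℝ) ≤ m := by exact_mod_cast Nat.one_le_iff_ne_zero.2 hempty.2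
  obtain ⟨G, hG, hGint⟩ := exists_noise_bound (m := m) hn X r hσ
  obtain ⟨hGi, hGle⟩ := hGint Ω μ E hE
  set τ := σ * Real.sqrt ((m : ℝ) + Real.log n) with hτ
  have hτ0 : 0 < τ := mul_pos hσ (Real.sqrt_pos.2 (by linarith))
  have hτ2 : τ ^ 2 = σ ^ 2 * ((m : ℝ) + Real.log n) := by
    rw [hτ, mul_pow, Real.sq_sqrt (by linarith)]
  have hlam : A * σ * Real.sqrt ((m : ℝ) + Real.log n) = A * τ := by rw [hτ]; ring
  rw [hlam] at hmin
  have hAϑ : 24 * (2 + ϑ) ≤ A * ϑ := (div_le_iff₀ hϑ).1 hA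
  set a := 3 * predLoss X (B - Bstar) (C - Cstar) + 18432 * (σ ^ 2 +
    σ ^ 2 * ((X.rank : ℝ) + m) * r) + 16 * A ^ 2 *
      (σ ^ 2 * K ^ 2 * ((rowSupport C).card : ℝ) * ((m : ℝ) + Real.log n)) with ha
  have hbound : ∀ᵐ ω ∂μ,
      predLoss X (Bhat ω - Bstar) (Chat ω - Cstar) ≤ a + 8 * G (E ω) := by
    filter_upwards [hmin] with ω hω
    have h := hω.predLoss_le (R := 2304 * (σ ^ 2 + σ ^ 2 * ((X.rank : ℝ) + m) * r) + G (E ω))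
      hτ0 hϑ hK (by nlinarith [mul_le_mul_of_nonneg_left hAϑ hτ0.le])
      (fun J U C' hU hC' => (hG (E ω) J U C' hU hC').trans (le_of_eq (by rw [hτ2]; ring)))
      hB hinc
    rw [mul_pow, hτ2] at h
    linarith
  have hdom : Integrable (fun ω => a + 8 * G (E ω)) μ :=
    (integrable_const a).add (hGi.const_mul 8)
  have hint : Integrable (fun ω => predLoss X (Bhat ω - Bstar) (Chat ω - Cstar)) μ := by
    refine hdom.mono' (aestronglyMeasurable_predLoss X Bstar Cstar hBm hCm) ?_
    filter_upwards [hbound] with ω hω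
    exact (Real.norm_of_nonneg (frobSq_nonneg _)).trans_le hω
  refine ⟨hint, (integral_mono_ae hint hdom hbound).trans ?_⟩
  rw [integral_add (integrable_const a) (hGi.const_mul 8), integral_const, integral_const_mul,
    probReal_univ, one_smul]
  have hA2 := sq_nonneg A
  have h1 := mul_nonneg hA2 hM0
  have h2 := mul_nonneg hA2 hσ2.le
  have h3 := mul_nonneg hA2 hR0
  linarith
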